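/- Let $R$ be an integral domain with quotient field $K$. For a nonzero fractional ideal $I$ of $R$ put $I^{-1}=\{x\in K : xI\subseteq R\}$, $I_v=(I^{-1})^{-1}$ and $I_t=\bigcup J_v$, the union being taken over all nonzero finitely generated fractional ideals $J\subseteq I$; call $I$ a $t$-ideal if $I=I_t$. Let $t\text{-Max}(R)$ be the set of maximal $t$-ideals of $R$, that is, of the ideals of $R$ that are maximal with respect to inclusion among the nonzero proper ideals of $R$ that are $t$-ideals. (Such ideals are prime; if $R$ is a field, there are none.) Call $R$ a $t\#$-domain if $$\bigcap_{M\in\mathcal M_1}R_M\neq\bigcap_{M\in\mathcal M_2}R_M$$ for any two distinct subsets $\mathcal M_1,\mathcal M_2$ of $t\text{-Max}(R)$, where the localizations $R_M$ are regarded as subrings of $K$ and the empty intersection is $K$. **Theorem.** If $R$ is a $t\#$-domain, then for every (finite or infinite, possibly empty) set $\{X_\alpha\}$ of indeterminates over $R$ the polynomial ring $R[\{X_\alpha\}]$ is a $t\#$-domain. -/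

import Mathlib

open scoped nonZeroDivisors

namespace TSharp

section

variable {R : Type*} [CommRing R] [IsDomain R] (K : Type*) [Field K] [Algebra R K]
  [IsFractionRing R K]

variable {K} in
/-- The `v`-closure `I_v = (I⁻¹)⁻¹` of a (nonzero) fractional ideal `I` of `R`,
where `I⁻¹ = (R :_K I)`. -/
noncomputable def vClosure (I : FractionalIdeal R⁰ K) : FractionalIdeal R⁰ K := (I⁻¹)⁻¹

variable {K} in
/-- The `t`-closure `I_t = ⋃ J_v` of a (nonzero) fractional ideal `I` of `R`, where `J` runs over
the nonzero finitely generated fractional ideals contained in `I`. -/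
def tClosure (I : FractionalIdeal R⁰ K) : Set K :=
  {x | ∃ J : FractionalIdeal R⁰ K, J ≠ 0 ∧ (J : Submodule R K).FG ∧ J ≤ I ∧ x ∈ vClosure J}

variable {K} in
/-- A `t`-ideal is a nonzero fractional ideal `I` with `I_t = I`. -/
def IsTIdeal (I : FractionalIdeal R⁰ K) : Prop :=
  I ≠ 0 ∧ tClosure I = {x | x ∈ I}

variable (R) in
/-- The set `t-Max(R)` of maximal `t`-ideals: the ideals of `R` that are maximal, with respect to
inclusion, among the proper integral `t`-ideals of `R`. -/
def tMax : Set (Ideal R) :=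
  {M | Maximal (fun I : Ideal R => I ≠ ⊤ ∧ IsTIdeal (I : FractionalIdeal R⁰ K)) M}

/-- The localization `R_M`, as a subset of the quotient field `K`: all fractions `a / s` with
`a, s ∈ R` and `s ∉ M` (so in particular `s ≠ 0`). It is used for prime ideals `M` only
(maximal `t`-ideals are prime). -/
def localizationAt (M : Ideal R) : Set K :=
  {x | ∃ a s : R, s ∉ M ∧ x = algebraMap R K a / algebraMap R K s}

end

/-- A domain `R` with quotient field `K` is a `t#`-domain if `⋂_{M ∈ 𝓜₁} R_M ≠ ⋂_{M ∈ 𝓜₂} R_M`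
for any two distinct subsets `𝓜₁` and `𝓜₂` of `t-Max(R)`. Intersections are taken inside `K`, so
the empty intersection is `K`. -/
def IsTSharpDomain (R : Type*) [CommRing R] [IsDomain R] : Prop :=
  ∀ 𝓜₁ 𝓜₂ : Set (Ideal R), 𝓜₁ ⊆ tMax R (FractionRing R) → 𝓜₂ ⊆ tMax R (FractionRing R) →
    𝓜₁ ≠ 𝓜₂ →
    (⋂ M ∈ 𝓜₁, localizationAt (FractionRing R) M) ≠ ⋂ M ∈ 𝓜₂, localizationAt (FractionRing R) M

end TSharp

/-!
A domain is a `t#`-domain if and only if for each maximal `t`-ideal `Q` some fraction lies in the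
localizations at all other maximal `t`-ideals but not in that at `Q` (`isTSharpDomain_iff`). Hulls,
`t`-ideals and such fractions are expressed by divisibility in the ring itself, so that they pass
through ring isomorphisms without mention of fraction fields.

Let `Q` be a maximal `t`-ideal of `D[X]`. Its contents give a `t`-ideal `J` of `D` with `Q ⊆ J[X]`, so
either `Q = J[X]` or some `f ∈ Q` has content with divisorial hull `D`
(`IsMaximalTIdeal.coeff_mem_or_exists_one_mem`). By McCoy's theorem such an `f` is regular modulo
each nonzero constant `a`, hence no proper `t`-ideal contains both `f` and `a`
(`IsIntegralTIdeal.eq_top_of_C_mem`). Therefore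
* if `Q ∩ D ≠ 0`, then `Q` is extended from `D`;
* if `Q ∩ D = 0`, then `d f = h g` for some nonzero `d ∈ D` and an `h ∈ Q` that generates `Q` over the
  fraction field of `D`, and `d / h = g / f` is the required fraction
  (`IsMaximalTIdeal.isSharpAt_of_C_mem_imp`).

For `R[σ]`, single out one indeterminate at a time. If `Q` meets the polynomial ring in the others in
zero for some choice, the second case applies. Otherwise `Q` is closed under taking coefficients with
respect to each indeterminate, whence `Q = P[σ]` with `P` a maximal `t`-ideal of `R`, and a fraction
that works for `P` works for `Q` (`IsMaximalTIdeal.isSharpAt_of_C_mem`).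
-/

namespace TSharp

/-! ### Divisorial hulls and maximal `t`-ideals -/

section Divisorial

variable {A : Type*} [CommRing A]

/-- The divisorial hull `(s)_v ∩ A` of a subset `s` of a domain `A`, described inside `A`: the
elements `x` such that each fraction `a / b` which multiplies `s` into `A` also multiplies `x`
into `A`. -/
def divisorialHull (s : Set A) : Ideal A where
  carrier := {x | ∀ a b : A, b ≠ 0 → (∀ j ∈ s, b ∣ a * j) → b ∣ a * x}
  add_mem' hx hy a b hb h := by
    rw [mul_add]
    exact dvd_add (hx a b hb h) (hy a b hb h)
  zero_mem' a b _ _ := by simp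
  smul_mem' c x hx a b hb h := by
    rw [smul_eq_mul, mul_left_comm]
    exact (hx a b hb h).mul_left c

lemma mem_divisorialHull {s : Set A} {x : A} :
    x ∈ divisorialHull s ↔ ∀ a b : A, b ≠ 0 → (∀ j ∈ s, b ∣ a * j) → b ∣ a * x :=
  Iff.rfl

lemma subset_divisorialHull (s : Set A) : s ⊆ divisorialHull s :=
  fun x hx _ _ _ h => h x hx

lemma divisorialHull_le {s t : Set A} (h : s ⊆ divisorialHull t) :
    divisorialHull s ≤ divisorialHull t :=
  fun _ hx a b hb hab => hx a b hb fun _ hj => h hj a b hb hab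

lemma divisorialHull_mono {s t : Set A} (h : s ⊆ t) : divisorialHull s ≤ divisorialHull t :=
  divisorialHull_le (h.trans (subset_divisorialHull t))

/-- Integral `t`-ideals, described without the fraction field: nonzero ideals which contain the
divisorial hull of each of their finite subsets. -/
structure IsIntegralTIdeal (I : Ideal A) : Prop where
  ne_bot : I ≠ ⊥
  hull_le : ∀ s : Finset A, (s : Set A) ⊆ I → divisorialHull (s : Set A) ≤ I

/-- Ideals that are maximal among the proper integral `t`-ideals. -/
def IsMaximalTIdeal (M : Ideal A) : Prop :=
  Maximal (fun I : Ideal A => I ≠ ⊤ ∧ IsIntegralTIdeal I) M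

lemma IsMaximalTIdeal.ne_top {M : Ideal A} (hM : IsMaximalTIdeal M) : M ≠ ⊤ := hM.prop.1

lemma IsMaximalTIdeal.isIntegralTIdeal {M : Ideal A} (hM : IsMaximalTIdeal M) :
    IsIntegralTIdeal M := hM.prop.2

lemma IsMaximalTIdeal.eq_of_le {M I : Ideal A} (hM : IsMaximalTIdeal M) (hI : I ≠ ⊤)
    (hI' : IsIntegralTIdeal I) (h : M ≤ I) : M = I :=
  Maximal.eq_of_le hM ⟨hI, hI'⟩ h

lemma IsIntegralTIdeal.exists_ne_zero {I : Ideal A} (hI : IsIntegralTIdeal I) :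
    ∃ x ∈ I, x ≠ 0 :=
  Submodule.exists_mem_ne_zero_of_ne_bot hI.ne_bot

lemma mem_iSup_divisorialHull {ι : Type*} [Nonempty ι] {s : ι → Set A}
    (hs : Directed (· ≤ ·) fun i => divisorialHull (s i)) {x : A} :
    x ∈ ⨆ i, divisorialHull (s i) ↔ ∃ i, x ∈ divisorialHull (s i) :=
  Submodule.mem_iSup_of_directed _ hs

lemma isIntegralTIdeal_iSup {ι : Type*} [Nonempty ι] {s : ι → Set A}
    (hs : Directed (· ≤ ·) fun i => divisorialHull (s i))
    (h0 : ∃ x, x ≠ 0 ∧ ∃ i, x ∈ divisorialHull (s i)) :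
    IsIntegralTIdeal (⨆ i, divisorialHull (s i)) where
  ne_bot h := by
    obtain ⟨x, hx, hi⟩ := h0
    rw [← mem_iSup_divisorialHull hs, h] at hi
    exact hx hi
  hull_le t ht := by
    obtain ⟨i, hi⟩ : ∃ i, (t : Set A) ⊆ divisorialHull (s i) := by
      refine Directed.exists_mem_subset_of_finset_subset_biUnion
        (f := fun i => (divisorialHull (s i) : Set A)) hs fun x hx => ?_
      simpa using (mem_iSup_divisorialHull hs).1 (ht hx)
    exact (divisorialHull_le hi).trans (le_iSup (fun i => divisorialHull (s i)) i)

/-- Maximal `t`-ideals are prime. If `x ∉ M`, then maximality gives a finite `F ⊆ M + (x)` whose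
divisorial hull contains `1`; multiplying by `y` puts `y` in the hull of `y F`, and `y F ⊆ M` as
soon as `x * y ∈ M`. -/
lemma IsMaximalTIdeal.isPrime {M : Ideal A} (hM : IsMaximalTIdeal M) : M.IsPrime := by
  classical
  refine ⟨hM.ne_top, fun {x y} hxy => or_iff_not_imp_left.2 fun hx => ?_⟩
  let s : {F : Finset A // (F : Set A) ⊆ (M ⊔ Ideal.span {x} : Ideal A)} → Set A :=
    fun F => (F.1 : Set A)
  have : Nonempty {F : Finset A // (F : Set A) ⊆ (M ⊔ Ideal.span {x} : Ideal A)} :=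
    ⟨⟨∅, by simp⟩⟩
  have hs : Directed (· ≤ ·) fun F => divisorialHull (s F) := by
    intro F G
    refine ⟨⟨F.1 ∪ G.1, ?_⟩, divisorialHull_mono ?_, divisorialHull_mono ?_⟩
    · rw [Finset.coe_union]
      exact Set.union_subset F.2 G.2
    · exact Finset.coe_subset.2 Finset.subset_union_left
    · exact Finset.coe_subset.2 Finset.subset_union_right
  have hle : M ⊔ Ideal.span {x} ≤ ⨆ F, divisorialHull (s F) := by
    intro z hz
    refine (mem_iSup_divisorialHull hs).2 ⟨⟨{z}, by simpa using hz⟩, ?_⟩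
    exact subset_divisorialHull _ (by simp [s])
  have hT : IsIntegralTIdeal (⨆ F, divisorialHull (s F)) := by
    obtain ⟨z, hz, hz0⟩ := hM.isIntegralTIdeal.exists_ne_zero
    exact isIntegralTIdeal_iSup hs
      ⟨z, hz0, (mem_iSup_divisorialHull hs).1 (hle (Ideal.mem_sup_left hz))⟩
  have htop : (⨆ F, divisorialHull (s F)) = ⊤ := by
    by_contra hne
    have := hM.eq_of_le hne hT (le_sup_left.trans hle)
    refine hx ?_
    rw [this]
    exact hle (Ideal.mem_sup_right (Ideal.mem_span_singleton_self x))
  obtain ⟨F, hF⟩ := (mem_iSup_divisorialHull hs).1 ((Ideal.eq_top_iff_one _).1 htop)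
  refine hM.isIntegralTIdeal.hull_le (F.1.image (y * ·)) ?_ ?_
  · intro w hw
    obtain ⟨z, hz, rfl⟩ := by simpa using hw
    obtain ⟨m, hm, r, rfl⟩ : ∃ m ∈ M, ∃ r, m + r * x = z := by
      obtain ⟨m, hm, n, hn, rfl⟩ := Submodule.mem_sup.1 (F.2 hz)
      obtain ⟨r, rfl⟩ := Ideal.mem_span_singleton'.1 hn
      exact ⟨m, hm, r, rfl⟩
    rw [show y * (m + r * x) = y * m + r * (x * y) by ring]
    exact M.add_mem (M.mul_mem_left _ hm) (M.mul_mem_left _ hxy)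
  · intro a b hb h
    have := hF (a * y) b hb fun j hj => by
      rw [mul_assoc]
      exact h _ (by simpa using ⟨j, hj, rfl⟩)
    simpa using this

/-- A fraction `a / b` that lies in the localization at each maximal `t`-ideal other than `Q`, but
not in the localization at `Q`. -/
def IsSharpAt (Q : Ideal A) : Prop :=
  ∃ a b : A, b ≠ 0 ∧ (∀ s, b ∣ s * a → s ∈ Q) ∧
    ∀ N : Ideal A, IsMaximalTIdeal N → N ≠ Q → ∃ s ∉ N, b ∣ s * a

end Divisorial

/-! ### Transport along ring isomorphisms -/

section Equiv

variable {A B : Type*} [CommRing A] [CommRing B]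

lemma IsIntegralTIdeal.comap (e : B ≃+* A) {I : Ideal A} (hI : IsIntegralTIdeal I) :
    IsIntegralTIdeal (I.comap e) where
  ne_bot h := by
    obtain ⟨x, hx, hx0⟩ := hI.exists_ne_zero
    have : e.symm x ∈ I.comap e := Ideal.mem_comap.2 (by simpa using hx)
    rw [h] at this
    exact hx0 (by simpa using this)
  hull_le s hs x hx := by
    classical
    refine hI.hull_le (s.image e) ?_ fun a b hb h => ?_
    · intro y hy
      obtain ⟨z, hz, rfl⟩ := by simpa using hy
      exact hs hz
    · have := hx (e.symm a) (e.symm b) (by simpa using hb) fun j hj => by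
        simpa using map_dvd e.symm (h (e j) (by simpa using hj))
      simpa using map_dvd e this

lemma IsMaximalTIdeal.comap (e : B ≃+* A) {I : Ideal A} (hI : IsMaximalTIdeal I) :
    IsMaximalTIdeal (I.comap e) := by
  refine ⟨⟨Ideal.comap_ne_top _ hI.ne_top, hI.isIntegralTIdeal.comap e⟩, fun J hJ hle x hx => ?_⟩
  have hIJ : I = J.comap e.symm := by
    refine hI.eq_of_le (Ideal.comap_ne_top _ hJ.1) (hJ.2.comap e.symm) fun y hy => ?_
    exact hle (Ideal.mem_comap.2 (by simpa using hy))
  rw [hIJ]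
  exact Ideal.mem_comap.2 (by simpa using hx)

lemma IsSharpAt.of_comap (e : B ≃+* A) {Q : Ideal A} (hQ : IsSharpAt (Q.comap e)) :
    IsSharpAt Q := by
  obtain ⟨a, b, hb, h1, h2⟩ := hQ
  refine ⟨e a, e b, by simpa using hb, fun s hs => ?_, fun N hN hNQ => ?_⟩
  · have := Ideal.mem_comap.1 (h1 (e.symm s) (by simpa using map_dvd e.symm hs))
    simpa using this
  · obtain ⟨s, hs, hsd⟩ := h2 (N.comap e) (hN.comap e) fun h => hNQ (by
      rw [← Ideal.comap_injective_of_surjective e e.surjective h])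
    exact ⟨e s, hs, by simpa using map_dvd e hsd⟩

end Equiv

/-! ### Extending `t`-ideals to polynomial rings -/

section Extension

/-- `t`-ideals extend to `t`-ideals along a free ring extension `D → A`; freeness enters through
coordinate functions `c i : A → D`. -/
lemma IsIntegralTIdeal.of_coords {D A ι : Type*} [CommRing D] [CommRing A] [IsDomain D]
    (φ : D →+* A) (hφ : Function.Injective φ) (c : ι → A → D)
    (hfin : ∀ x, (Set.range fun i => c i x).Finite)
    (hmul : ∀ d x i, c i (φ d * x) = d * c i x) (hdvd : ∀ d x, φ d ∣ x ↔ ∀ i, d ∣ c i x)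
    {P : Ideal D} (hP : IsIntegralTIdeal P) {I : Ideal A} (hI : ∀ x, x ∈ I ↔ ∀ i, c i x ∈ P) :
    IsIntegralTIdeal I where
  ne_bot h := by
    obtain ⟨d, hd, hd0⟩ := hP.exists_ne_zero
    have : φ d ∈ I := (hI _).2 fun i => by
      rw [← mul_one (φ d), hmul]
      exact P.mul_mem_right _ hd
    rw [h] at this
    exact hd0 (hφ (by simpa using this))
  hull_le s hs x hx := by
    classical
    refine (hI x).2 fun i => ?_
    have hfin' : (⋃ j ∈ s, Set.range fun i => c i j).Finite :=
      s.finite_toSet.biUnion fun j _ => hfin j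
    refine hP.hull_le hfin'.toFinset ?_ fun a b hb h => ?_
    · intro y hy
      obtain ⟨j, hj, k, rfl⟩ := by simpa using hy
      exact (hI j).1 (hs hj) k
    · rw [← hmul]
      refine (hdvd _ _).1 (hx (φ a) (φ b) ((map_ne_zero_iff φ hφ).2 hb) fun j hj => ?_) i
      refine (hdvd _ _).2 fun k => ?_
      rw [hmul]
      refine h _ ?_
      rw [Set.Finite.coe_toFinset]
      exact Set.mem_biUnion hj ⟨k, rfl⟩

lemma IsIntegralTIdeal.map_polynomialC {D : Type*} [CommRing D] [IsDomain D] {P : Ideal D}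
    (hP : IsIntegralTIdeal P) : IsIntegralTIdeal (P.map (Polynomial.C : D →+* Polynomial D)) :=
  hP.of_coords Polynomial.C Polynomial.C_injective (fun n f => f.coeff n)
    (fun f => f.finite_range_coeff) (fun _ f _ => Polynomial.coeff_C_mul f)
    (fun d f => Polynomial.C_dvd_iff_dvd_coeff d f) fun _ => Ideal.mem_map_C_iff

lemma IsIntegralTIdeal.map_mvPolynomialC {D σ : Type*} [CommRing D] [IsDomain D] {P : Ideal D}
    (hP : IsIntegralTIdeal P) :
    IsIntegralTIdeal (P.map (MvPolynomial.C : D →+* MvPolynomial σ D)) :=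
  hP.of_coords MvPolynomial.C (MvPolynomial.C_injective σ D) (fun m f => f.coeff m)
    (fun f => by
      classical
      refine (f.support.image f.coeff ∪ {0}).finite_toSet.subset ?_
      rintro _ ⟨m, rfl⟩
      by_cases hm : f.coeff m = 0
      · simp [hm]
      · simpa [hm] using ⟨m, hm, rfl⟩)
    (fun d f m => MvPolynomial.coeff_C_mul m d f)
    (fun d f => MvPolynomial.C_dvd_iff_dvd_coeff d f) fun _ => MvPolynomial.mem_map_C_iff

end Extension

/-! ### Maximal `t`-ideals in one indeterminate -/

section OneVariable

open Polynomial

variable {D : Type*} [CommRing D]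

/-- A polynomial whose content has divisorial hull `D` is a nonzerodivisor modulo each constant:
by McCoy's theorem a zero divisor modulo `a` would be killed by a nonzero constant modulo `a`. -/
lemma C_dvd_of_C_dvd_mul {f g : D[X]} (hf : (1 : D) ∈ divisorialHull (Set.range f.coeff)) {a : D}
    (ha : a ≠ 0) (h : C a ∣ g * f) : C a ∣ g := by
  have key : ∀ p : D[X], p.map (Ideal.Quotient.mk (Ideal.span {a})) = 0 ↔ C a ∣ p := by
    intro p
    rw [C_dvd_iff_dvd_coeff, Polynomial.ext_iff]
    simp [Ideal.Quotient.eq_zero_iff_mem, Ideal.mem_span_singleton]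
  rw [← key] at h ⊢
  rw [Polynomial.map_mul] at h
  have hreg : f.map (Ideal.Quotient.mk (Ideal.span {a})) ∈ (D ⧸ Ideal.span {a})[X]⁰ := by
    rw [Polynomial.mem_nonZeroDivisors_iff]
    intro r hr
    obtain ⟨r, rfl⟩ := Ideal.Quotient.mk_surjective r
    rw [Ideal.Quotient.eq_zero_iff_mem, Ideal.mem_span_singleton]
    suffices a ∣ r * 1 by simpa using this
    refine hf r a ha ?_
    rintro _ ⟨n, rfl⟩
    have := congrArg (fun p => p.coeff n) hr
    simpa [← map_mul, Ideal.Quotient.eq_zero_iff_mem, Ideal.mem_span_singleton] using this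
  exact (mul_right_mem_nonZeroDivisors_eq_zero_iff hreg).1 h

variable [IsDomain D]

/-- Either a maximal `t`-ideal `Q` of `D[X]` is extended from `D`, or it contains a polynomial whose
content has divisorial hull `D`. The hulls of the contents of the elements of `Q` form a directed
family, the content of `f + X ^ n * g` being the sum of those of `f` and `g` for large `n`. Their
union is a `t`-ideal `J` of `D`, and `Q ⊆ J[X]`. -/
lemma IsMaximalTIdeal.coeff_mem_or_exists_one_mem {Q : Ideal D[X]} (hQ : IsMaximalTIdeal Q) :
    (∀ f ∈ Q, ∀ n, C (f.coeff n) ∈ Q) ∨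
      ∃ f ∈ Q, (1 : D) ∈ divisorialHull (Set.range f.coeff) := by
  let s : Q → Set D := fun f => Set.range f.1.coeff
  have hs : Directed (· ≤ ·) fun f => divisorialHull (s f) := by
    intro f g
    refine ⟨f + (X ^ (f.1.natDegree + 1) : D[X]) • g, divisorialHull_le ?_,
      divisorialHull_mono ?_⟩
    · rintro _ ⟨n, rfl⟩
      rcases le_or_gt n f.1.natDegree with hn | hn
      · refine subset_divisorialHull _ ⟨n, ?_⟩
        simp [coeff_X_pow_mul', show ¬ f.1.natDegree + 1 ≤ n by omega]
      · rw [coeff_eq_zero_of_natDegree_lt hn]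
        exact zero_mem _
    · rintro _ ⟨n, rfl⟩
      refine ⟨n + (f.1.natDegree + 1), ?_⟩
      simp [coeff_X_pow_mul, coeff_eq_zero_of_natDegree_lt
        (show f.1.natDegree < n + (f.1.natDegree + 1) by omega)]
  by_cases h1 : (1 : D) ∈ ⨆ f, divisorialHull (s f)
  · obtain ⟨f, hf⟩ := (mem_iSup_divisorialHull hs).1 h1
    exact Or.inr ⟨f, f.2, hf⟩
  · left
    have hT : IsIntegralTIdeal (⨆ f, divisorialHull (s f)) := by
      obtain ⟨f, hf, hf0⟩ := hQ.isIntegralTIdeal.exists_ne_zero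
      exact isIntegralTIdeal_iSup hs ⟨f.leadingCoeff, leadingCoeff_ne_zero.2 hf0, ⟨f, hf⟩,
        subset_divisorialHull _ ⟨f.natDegree, rfl⟩⟩
    have hQJ : Q = (⨆ f, divisorialHull (s f)).map (C : D →+* D[X]) := by
      refine hQ.eq_of_le ?_ hT.map_polynomialC fun f hf => ?_
      · rw [Ne, Ideal.eq_top_iff_one, Ideal.mem_map_C_iff]
        exact fun h => h1 (by simpa using h 0)
      · rw [Ideal.mem_map_C_iff]
        exact fun n => (mem_iSup_divisorialHull hs).2
          ⟨⟨f, hf⟩, subset_divisorialHull _ ⟨n, rfl⟩⟩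
    intro f hf n
    rw [hQJ] at hf ⊢
    exact Ideal.mem_map_of_mem _ (Ideal.mem_map_C_iff.1 hf n)

/-- A nonzero constant `a` and a polynomial `f` whose content has divisorial hull `D` generate an
ideal of `D[X]` with trivial inverse, so no proper `t`-ideal contains both. -/
lemma IsIntegralTIdeal.eq_top_of_C_mem {N : Ideal D[X]} (hN : IsIntegralTIdeal N) {a : D}
    (ha : a ≠ 0) (haN : C a ∈ N) {f : D[X]} (hfN : f ∈ N)
    (hf : (1 : D) ∈ divisorialHull (Set.range f.coeff)) : N = ⊤ := by
  classical
  rw [Ideal.eq_top_iff_one]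
  refine hN.hull_le {C a, f} ?_ fun α β hβ h => ?_
  · intro x hx
    rcases (by simpa using hx : x = C a ∨ x = f) with rfl | rfl <;> assumption
  · have hCa : (C a : D[X]) ≠ 0 := C_ne_zero.2 ha
    obtain ⟨g, hg⟩ := h (C a) (by simp)
    obtain ⟨k, hk⟩ := h f (by simp)
    obtain ⟨g', rfl⟩ : C a ∣ g := by
      refine C_dvd_of_C_dvd_mul hf ha ⟨k, mul_left_cancel₀ hβ ?_⟩
      linear_combination C a * hk - f * hg
    exact ⟨g', mul_right_cancel₀ hCa (by linear_combination hg)⟩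

lemma IsMaximalTIdeal.C_coeff_mem {Q : Ideal D[X]} (hQ : IsMaximalTIdeal Q) {d : D} (hd : d ≠ 0)
    (hdQ : C d ∈ Q) {f : D[X]} (hf : f ∈ Q) (n : ℕ) : C (f.coeff n) ∈ Q := by
  rcases hQ.coeff_mem_or_exists_one_mem with h | ⟨g, hg, hg1⟩
  · exact h f hf n
  · exact absurd (hQ.isIntegralTIdeal.eq_top_of_C_mem hd hdQ hg hg1) hQ.ne_top

/-- In an ideal which meets the constants in zero, a nonzero element `h` of least degree divides
each element up to a nonzero constant. -/
lemma exists_dvd_C_mul_of_minimal {Q : Ideal D[X]} (hQ : ∀ d, C d ∈ Q → d = 0) {h : D[X]}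
    (hh : h ∈ Q) (hh0 : h ≠ 0) (hmin : ∀ q ∈ Q, q ≠ 0 → h.natDegree ≤ q.natDegree) :
    ∀ q ∈ Q, ∃ d : D, d ≠ 0 ∧ h ∣ C d * q := by
  intro q
  induction hn : q.natDegree using Nat.strong_induction_on generalizing q with
  | _ n ih =>
    intro hq
    by_cases hq0 : q = 0
    · exact ⟨1, one_ne_zero, by simp [hq0]⟩
    have hle := hmin q hq hq0
    have hpos : 0 < q.natDegree := by
      by_contra hlt
      rw [eq_C_of_natDegree_eq_zero (Nat.eq_zero_of_not_pos hlt)] at hq hq0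
      exact hq0 (by rw [hQ _ hq, C_0])
    have hr : h.cancelLeads q ∈ Q :=
      Q.sub_mem (Q.mul_mem_left _ hq) (Q.mul_mem_left _ hh)
    obtain ⟨d, hd, k, hk⟩ :=
      ih _ (hn ▸ natDegree_cancelLeads_lt_of_natDegree_le_natDegree hle hpos) _ rfl hr
    refine ⟨d * h.leadingCoeff, mul_ne_zero hd (leadingCoeff_ne_zero.2 hh0),
      k + C d * (C q.leadingCoeff * X ^ (q.natDegree - h.natDegree)), ?_⟩
    rw [cancelLeads, Nat.sub_eq_zero_of_le hle] at hk
    rw [C_mul]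
    linear_combination hk

/-- Let `f ∈ Q` have content with divisorial hull `D`, and let `h ∈ Q` be nonzero of least degree,
so that `d f = h g` with `0 ≠ d ∈ D`. The fraction `d / h = g / f` is not in the localization at
`Q`. A maximal `t`-ideal `N` containing both `h` and `f` meets `D` in zero, whence it contains
each `q ∈ Q`, as a nonzero constant multiple of `q` is divisible by `h`. -/
lemma IsMaximalTIdeal.isSharpAt_of_C_mem_imp {Q : Ideal D[X]} (hQ : IsMaximalTIdeal Q)
    (hQ0 : ∀ d, C d ∈ Q → d = 0) : IsSharpAt Q := by
  classical
  have hex : ∃ n, ∃ q ∈ Q, q ≠ 0 ∧ q.natDegree = n := by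
    obtain ⟨q, hq, hq0⟩ := hQ.isIntegralTIdeal.exists_ne_zero
    exact ⟨_, q, hq, hq0, rfl⟩
  obtain ⟨h, hh, hh0, hdeg⟩ := Nat.find_spec hex
  have hdiv := exists_dvd_C_mul_of_minimal hQ0 hh hh0 fun q hq hq0 => by
    rw [hdeg]
    exact Nat.find_min' hex ⟨q, hq, hq0, rfl⟩
  obtain ⟨f, hf, hf1⟩ : ∃ f ∈ Q, (1 : D) ∈ divisorialHull (Set.range f.coeff) := by
    refine hQ.coeff_mem_or_exists_one_mem.resolve_left fun hall => hh0 ?_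
    ext n
    exact hQ0 _ (hall h hh n)
  obtain ⟨d, hd, hdf⟩ := hdiv f hf
  refine ⟨C d, h, hh0, fun s hs => ?_, fun N hN hNQ => ?_⟩
  · exact (hQ.isPrime.mem_or_mem (Q.mem_of_dvd hs hh)).resolve_right fun hdQ => hd (hQ0 d hdQ)
  · by_contra! hcon
    have hhN : h ∈ N := by
      by_contra hhN
      exact hcon h hhN (dvd_mul_right _ _)
    have hfN : f ∈ N := by
      by_contra hfN
      exact hcon f hfN (by rwa [mul_comm])
    refine hNQ (hQ.eq_of_le hN.ne_top hN.isIntegralTIdeal fun q hq => ?_).symm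
    obtain ⟨c, hc, hcq⟩ := hdiv q hq
    refine (hN.isPrime.mem_or_mem (N.mem_of_dvd hcq hhN)).resolve_left fun hcN => ?_
    exact hN.ne_top (hN.isIntegralTIdeal.eq_top_of_C_mem hc hcN hfN hf1)

end OneVariable

/-! ### Maximal `t`-ideals in several indeterminates -/

section SeveralVariables

open MvPolynomial

variable {R σ : Type*} [CommRing R]

variable (R) in
/-- `R[σ]` as the ring of polynomials in `X_y` over the polynomial ring in the other
indeterminates. -/
noncomputable def singleOut (y : σ) :
    MvPolynomial σ R ≃+* Polynomial (MvPolynomial {x // x ≠ y} R) :=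
  open scoped Classical in
  ((renameEquiv R (Equiv.optionSubtypeNe y).symm).trans
    (optionEquivLeft R {x // x ≠ y})).toRingEquiv

lemma singleOut_C (y : σ) (r : R) : singleOut R y (C r) = Polynomial.C (C r) := by
  simp [singleOut]

lemma coeff_singleOut (y : σ) (f : MvPolynomial σ R) (m : σ →₀ ℕ) :
    coeff (m.subtypeDomain (· ≠ y)) ((singleOut R y f).coeff (m y)) = coeff m f := by
  classical
  have h := optionEquivLeft_coeff_some_coeff_none R {x // x ≠ y}
    (m.mapDomain (Equiv.optionSubtypeNe y).symm) (rename (Equiv.optionSubtypeNe y).symm f)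
  rw [coeff_rename_mapDomain _ (Equiv.injective _)] at h
  have h1 : (m.mapDomain (Equiv.optionSubtypeNe y).symm) none = m y := by
    rw [← Equiv.optionSubtypeNe_symm_self y, Finsupp.mapDomain_apply (Equiv.injective _)]
  have h2 : (m.mapDomain (Equiv.optionSubtypeNe y).symm).some = m.subtypeDomain (· ≠ y) := by
    ext x
    rw [Finsupp.some_apply, Finsupp.subtypeDomain_apply,
      show some x = (Equiv.optionSubtypeNe y).symm x.1 by
        rw [Equiv.optionSubtypeNe_symm_of_ne x.2],
      Finsupp.mapDomain_apply (Equiv.injective _)]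
  rw [h1, h2] at h
  convert h using 3
  simp [singleOut]

/-- Taking the coefficients with respect to one indeterminate after another reaches the
coefficients in `R`, as only finitely many indeterminates occur in a polynomial. -/
lemma C_coeff_mem_of_singleOut {Q : Ideal (MvPolynomial σ R)}
    (hQ : ∀ y, ∀ f ∈ Q, ∀ n,
      (singleOut R y).symm (Polynomial.C ((singleOut R y f).coeff n)) ∈ Q)
    {f : MvPolynomial σ R} (hf : f ∈ Q) (m : σ →₀ ℕ) : C (coeff m f) ∈ Q := by
  classical
  suffices H : ∀ S : Finset σ, ∀ f ∈ Q, (∀ m ∈ f.support, ∀ y ∉ S, m y = 0) →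
      ∀ m, C (coeff m f) ∈ Q by
    refine H f.vars f hf (fun m hm y hy => ?_) m
    by_contra h0
    exact hy ((mem_vars_iff_mem_support y).2 ⟨m, hm, by simpa using h0⟩)
  intro S
  induction S using Finset.induction_on with
  | empty =>
    intro f hf hsupp m
    have hfC : f = C (coeff 0 f) := by
      ext k
      rw [coeff_C]
      split_ifs with hk
      · rw [hk]
      · by_contra hne
        exact hk (Finsupp.ext fun y =>
          (hsupp k (mem_support_iff.2 hne) y (Finset.notMem_empty y)).symm)
    by_cases hm : m = 0
    · rw [hm, ← hfC]
      exact hf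
    · rw [hfC, coeff_C, if_neg (Ne.symm hm), C_0]
      exact zero_mem _
  | insert y S hy ih =>
    intro f hf hsupp m
    set g := (singleOut R y).symm (Polynomial.C ((singleOut R y f).coeff (m y))) with hg
    have hcoeff : ∀ k : σ →₀ ℕ,
        coeff k g = if k y = 0 then coeff (k.update y (m y)) f else 0 := by
      intro k
      rw [← coeff_singleOut y g k, hg, RingEquiv.apply_symm_apply, Polynomial.coeff_C]
      split_ifs with hk
      · rw [← coeff_singleOut y f (k.update y (m y))]
        have : (k.update y (m y)).subtypeDomain (· ≠ y) = k.subtypeDomain (· ≠ y) := by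
          ext x
          simp [Function.update_of_ne x.2]
        simp [this]
      · simp
    have hmem := ih g (hQ y f hf (m y)) ?_ (m.erase y)
    · rw [hcoeff, if_pos (Finsupp.erase_same)] at hmem
      convert hmem using 3
      ext x
      by_cases hx : x = y <;> simp [hx]
    · intro k hk x hx
      rw [mem_support_iff, hcoeff] at hk
      split_ifs at hk with hky
      · by_cases hxy : x = y
        · rw [hxy, hky]
        · have := hsupp _ (mem_support_iff.2 hk) x (by simp [hx, hxy])
          simpa [Function.update_of_ne hxy] using this
      · exact absurd rfl hk

lemma IsMaximalTIdeal.exists_C_mem {Q : Ideal (MvPolynomial σ R)} (hQ : IsMaximalTIdeal Q)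
    (h : ∀ f ∈ Q, ∀ m, C (coeff m f) ∈ Q) : ∃ d : R, d ≠ 0 ∧ C d ∈ Q := by
  obtain ⟨f, hf, hf0⟩ := hQ.isIntegralTIdeal.exists_ne_zero
  obtain ⟨m, hm⟩ := ne_zero_iff.1 hf0
  exact ⟨_, hm, h f hf m⟩

lemma map_mvPolynomialC_ne_top {P : Ideal R} (hP : P ≠ ⊤) :
    P.map (C : R →+* MvPolynomial σ R) ≠ ⊤ := by
  rw [Ne, Ideal.eq_top_iff_one, mem_map_C_iff]
  exact fun h => hP ((Ideal.eq_top_iff_one _).2 (by simpa using h 0))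

variable [IsDomain R]

lemma IsMaximalTIdeal.C_coeff_mem_of_forall {Q : Ideal (MvPolynomial σ R)} (hQ : IsMaximalTIdeal Q)
    (h : ∀ y, ∃ d, d ≠ 0 ∧ (singleOut R y).symm (Polynomial.C d) ∈ Q) {f : MvPolynomial σ R}
    (hf : f ∈ Q) (m : σ →₀ ℕ) : C (coeff m f) ∈ Q := by
  refine C_coeff_mem_of_singleOut (fun y g hg n => ?_) hf m
  obtain ⟨d, hd, hdQ⟩ := h y
  exact (hQ.comap (singleOut R y).symm).C_coeff_mem hd hdQ (f := singleOut R y g)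
    (by simpa using hg) n

lemma IsMaximalTIdeal.C_coeff_mem_of_C_mem {Q : Ideal (MvPolynomial σ R)}
    (hQ : IsMaximalTIdeal Q) {d : R} (hd : d ≠ 0) (hdQ : C d ∈ Q) {f : MvPolynomial σ R}
    (hf : f ∈ Q) (m : σ →₀ ℕ) : C (coeff m f) ∈ Q :=
  hQ.C_coeff_mem_of_forall
    (fun y => ⟨C d, (map_ne_zero_iff C (C_injective _ R)).2 hd, by
      rwa [← singleOut_C, RingEquiv.symm_apply_apply]⟩) hf m

/-- If `Q` contains no nonzero constant, then `Q` contracts to zero in the polynomial ring omitting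
some `X_y`, since otherwise all coefficients of its elements would be in `Q`. This reduces to one
indeterminate. -/
lemma IsMaximalTIdeal.isSharpAt_of_forall_C_notMem {Q : Ideal (MvPolynomial σ R)}
    (hQ : IsMaximalTIdeal Q) (hQ0 : ∀ d : R, C d ∈ Q → d = 0) : IsSharpAt Q := by
  by_contra hns
  obtain ⟨d, hd, hdQ⟩ := hQ.exists_C_mem fun f hf m => by
    refine hQ.C_coeff_mem_of_forall (fun y => ?_) hf m
    by_contra! hy
    refine hns (IsSharpAt.of_comap (singleOut R y).symm
      ((hQ.comap _).isSharpAt_of_C_mem_imp fun d hd => ?_))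
    by_contra hd0
    exact hy d hd0 hd
  exact hd (hQ0 d hdQ)

lemma IsMaximalTIdeal.eq_map_comap_C {Q : Ideal (MvPolynomial σ R)} (hQ : IsMaximalTIdeal Q)
    {d : R} (hd : d ≠ 0) (hdQ : C d ∈ Q) :
    Q = (Q.comap (C : R →+* MvPolynomial σ R)).map C :=
  le_antisymm (fun _ hf => mem_map_C_iff.2 fun m => hQ.C_coeff_mem_of_C_mem hd hdQ hf m)
    Ideal.map_comap_le

/-- A fraction `a / b` multiplying a nonzero constant `j` into `R[σ]` has the form `g / j`; hence
the hull of a set of constants, one of them nonzero, can be tested on the coefficients of `g`. -/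
lemma C_mem_divisorialHull_image {s : Set R} (hs : ∃ j ∈ s, j ≠ 0) {x : R}
    (hx : x ∈ divisorialHull s) :
    (C x : MvPolynomial σ R) ∈ divisorialHull (C '' s) := by
  intro a b hb h
  obtain ⟨j, hj, hj0⟩ := hs
  have hCj : (C j : MvPolynomial σ R) ≠ 0 := (map_ne_zero_iff C (C_injective _ R)).2 hj0
  obtain ⟨g, hg⟩ := h _ ⟨j, hj, rfl⟩
  obtain ⟨k, hk⟩ : C j ∣ g * C x := by
    rw [C_dvd_iff_dvd_coeff]
    intro m
    rw [mul_comm g, coeff_C_mul, mul_comm]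
    refine hx _ _ hj0 fun i hi => ?_
    rw [mul_comm, ← coeff_C_mul]
    refine (C_dvd_iff_dvd_coeff _ _).1 ?_ m
    obtain ⟨l, hl⟩ := h _ ⟨i, hi, rfl⟩
    exact ⟨l, mul_left_cancel₀ hb (by linear_combination C j * hl - C i * hg)⟩
  exact ⟨k, mul_right_cancel₀ hCj (by linear_combination C x * hg + b * hk)⟩

lemma IsIntegralTIdeal.comap_mvPolynomialC {Q : Ideal (MvPolynomial σ R)}
    (hQ : IsIntegralTIdeal Q) {d : R} (hd : d ≠ 0) (hdQ : C d ∈ Q) :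
    IsIntegralTIdeal (Q.comap (C : R →+* MvPolynomial σ R)) where
  ne_bot h := by
    have : d ∈ Q.comap (C : R →+* MvPolynomial σ R) := hdQ
    rw [h] at this
    exact hd this
  hull_le s hs x hx := by
    classical
    have h1 : x ∈ divisorialHull ((insert d s : Finset R) : Set R) :=
      divisorialHull_mono (by simp) hx
    have h2 := C_mem_divisorialHull_image (σ := σ) ⟨d, by simp, hd⟩ h1
    rw [← Finset.coe_image] at h2
    refine hQ.hull_le _ ?_ h2
    intro y hy
    obtain rfl | ⟨z, hz, rfl⟩ := (by simpa using hy : y = C d ∨ ∃ z ∈ s, C z = y)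
    · exact hdQ
    · exact hs hz

lemma IsMaximalTIdeal.comap_mvPolynomialC {Q : Ideal (MvPolynomial σ R)} (hQ : IsMaximalTIdeal Q)
    {d : R} (hd : d ≠ 0) (hdQ : C d ∈ Q) :
    IsMaximalTIdeal (Q.comap (C : R →+* MvPolynomial σ R)) := by
  refine ⟨⟨Ideal.comap_ne_top _ hQ.ne_top, hQ.isIntegralTIdeal.comap_mvPolynomialC hd hdQ⟩,
    fun P hP hle x hx => ?_⟩
  have hQP : Q = P.map C := by
    refine hQ.eq_of_le (map_mvPolynomialC_ne_top hP.1) hP.2.map_mvPolynomialC ?_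
    rw [hQ.eq_map_comap_C hd hdQ]
    exact Ideal.map_mono hle
  rw [hQP]
  exact Ideal.mem_map_of_mem C hx

/-- The fraction that separates `Q ∩ R` from the other maximal `t`-ideals of `R` also separates
`Q`: a maximal `t`-ideal of `R[σ]` either contains no nonzero constant, in particular not the
denominator, or is extended from a maximal `t`-ideal of `R`. -/
lemma IsMaximalTIdeal.isSharpAt_of_C_mem
    (hR : ∀ P : Ideal R, IsMaximalTIdeal P → IsSharpAt P) {Q : Ideal (MvPolynomial σ R)}
    (hQ : IsMaximalTIdeal Q) {d : R} (hd : d ≠ 0) (hdQ : C d ∈ Q) : IsSharpAt Q := by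
  obtain ⟨a, b, hb, h1, h2⟩ := hR _ (hQ.comap_mvPolynomialC hd hdQ)
  refine ⟨C a, C b, (map_ne_zero_iff C (C_injective _ R)).2 hb, fun s hs => ?_,
    fun N hN hNQ => ?_⟩
  · rw [hQ.eq_map_comap_C hd hdQ, mem_map_C_iff]
    intro m
    refine h1 _ ?_
    rw [mul_comm, ← coeff_C_mul, mul_comm]
    exact (C_dvd_iff_dvd_coeff _ _).1 hs m
  · by_cases hbN : C b ∈ N
    · obtain ⟨s, hs, hsd⟩ := h2 _ (hN.comap_mvPolynomialC hb hbN) fun h => hNQ (by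
        rw [hQ.eq_map_comap_C hd hdQ, hN.eq_map_comap_C hb hbN, h])
      exact ⟨C s, hs, by simpa using map_dvd (C : R →+* MvPolynomial σ R) hsd⟩
    · exact ⟨C b, hbN, dvd_mul_right _ _⟩

end SeveralVariables

/-! ### Comparison with fractional ideals and localizations -/

section FractionField

variable {R : Type*} [CommRing R] {K : Type*} [Field K] [Algebra R K] [IsFractionRing R K]

lemma algebraMap_mul_div_mem_one {a b x : R} (hb : b ≠ 0) :
    algebraMap R K a / algebraMap R K b * algebraMap R K x ∈ (1 : FractionalIdeal R⁰ K) ↔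
      b ∣ a * x := by
  have hb' : algebraMap R K b ≠ 0 := by simpa using hb
  rw [FractionalIdeal.mem_one_iff, div_mul_eq_mul_div, ← map_mul]
  refine exists_congr fun c => ?_
  rw [eq_div_iff hb', ← map_mul, (IsFractionRing.injective R K).eq_iff, mul_comm, eq_comm]

lemma div_mem_localizationAt_iff {M : Ideal R} {a b : R} (hb : b ≠ 0) :
    algebraMap R K a / algebraMap R K b ∈ localizationAt K M ↔ ∃ s ∉ M, b ∣ s * a := by
  have hb' : algebraMap R K b ≠ 0 := by simpa using hb
  constructor
  · rintro ⟨c, s, hs, h⟩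
    have hs' : algebraMap R K s ≠ 0 := by
      rw [Ne, FaithfulSMul.algebraMap_eq_zero_iff]
      rintro rfl
      exact hs M.zero_mem
    rw [div_eq_div_iff hb' hs', ← map_mul, ← map_mul] at h
    refine ⟨s, hs, c, ?_⟩
    rw [mul_comm s, IsFractionRing.injective R K h, mul_comm]
  · rintro ⟨s, hs, c, hc⟩
    refine ⟨c, s, hs, ?_⟩
    have hs' : algebraMap R K s ≠ 0 := by
      rw [Ne, FaithfulSMul.algebraMap_eq_zero_iff]
      rintro rfl
      exact hs M.zero_mem
    rw [div_eq_div_iff hb' hs', ← map_mul, ← map_mul, mul_comm a, hc, mul_comm]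

variable [IsDomain R]

lemma one_le_inv {J : FractionalIdeal R⁰ K} (h0 : J ≠ 0) (h : J ≤ 1) : 1 ≤ J⁻¹ := by
  intro x hx
  refine (FractionalIdeal.mem_inv_iff h0).2 fun y hy => ?_
  rw [← one_mul (1 : FractionalIdeal R⁰ K)]
  exact FractionalIdeal.mul_mem_mul hx (h hy)

lemma inv_ne_zero_of_le_one {J : FractionalIdeal R⁰ K} (h0 : J ≠ 0) (h : J ≤ 1) : J⁻¹ ≠ 0 := by
  intro h1
  have := one_le_inv h0 h
  rw [h1] at this
  exact one_ne_zero (le_antisymm this (FractionalIdeal.zero_le _))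

lemma algebraMap_mem_vClosure_span {s : Finset R} (hs : ∃ j ∈ s, j ≠ 0) {x : R} :
    algebraMap R K x ∈ vClosure ((Ideal.span (s : Set R) : Ideal R) : FractionalIdeal R⁰ K) ↔
      x ∈ divisorialHull (s : Set R) := by
  have hs0 : ((Ideal.span (s : Set R) : Ideal R) : FractionalIdeal R⁰ K) ≠ 0 := by
    obtain ⟨j, hj, hj0⟩ := hs
    rw [FractionalIdeal.coeIdeal_ne_zero]
    intro h
    rw [Ideal.span_eq_bot] at h
    exact hj0 (h j hj)
  have hinv : ∀ a b : R, b ≠ 0 → (algebraMap R K a / algebraMap R K b ∈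
      ((Ideal.span (s : Set R) : Ideal R) : FractionalIdeal R⁰ K)⁻¹ ↔ ∀ j ∈ s, b ∣ a * j) := by
    intro a b hb
    rw [FractionalIdeal.mem_inv_iff hs0]
    constructor
    · intro h j hj
      exact (algebraMap_mul_div_mem_one hb).1
        (h _ (FractionalIdeal.mem_coeIdeal_of_mem _ (Ideal.subset_span hj)))
    · intro h y hy
      obtain ⟨z, hz, rfl⟩ := (FractionalIdeal.mem_coeIdeal _).1 hy
      rw [algebraMap_mul_div_mem_one hb]
      have : Ideal.span (s : Set R) ≤ Submodule.comap (LinearMap.mulLeft R a) (Ideal.span {b}) :=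
        Ideal.span_le.2 fun j hj => Ideal.mem_span_singleton.2 (h j hj)
      exact Ideal.mem_span_singleton.1 (this hz)
  rw [vClosure, FractionalIdeal.mem_inv_iff
    (inv_ne_zero_of_le_one hs0 FractionalIdeal.coeIdeal_le_one), mem_divisorialHull]
  constructor
  · intro h a b hb hab
    rw [← algebraMap_mul_div_mem_one (K := K) hb, mul_comm]
    exact h _ ((hinv a b hb).2 hab)
  · intro h y hy
    obtain ⟨a, b, hb, rfl⟩ := IsFractionRing.div_surjective (A := R) y
    have hb0 := nonZeroDivisors.ne_zero hb
    rw [mul_comm, algebraMap_mul_div_mem_one hb0]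
    exact h a b hb0 ((hinv a b hb0).1 hy)

lemma vClosure_le_one {J : FractionalIdeal R⁰ K} (h0 : J ≠ 0) (h : J ≤ 1) : vClosure J ≤ 1 := by
  intro x hx
  have := (FractionalIdeal.mem_inv_iff (inv_ne_zero_of_le_one h0 h)).1 hx 1
    (one_le_inv h0 h (FractionalIdeal.one_mem_one _))
  simpa using this

lemma isTIdeal_coeIdeal_iff {I : Ideal R} :
    IsTIdeal (I : FractionalIdeal R⁰ K) ↔ IsIntegralTIdeal I := by
  classical
  have hfg : ∀ J : Ideal R, ((J : FractionalIdeal R⁰ K) : Submodule R K).FG ↔ J.FG :=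
    FractionalIdeal.coeIdeal_fg R⁰ (IsFractionRing.injective R K)
  constructor
  · rintro ⟨h0, h⟩
    have hI0 : I ≠ ⊥ := FractionalIdeal.coeIdeal_ne_zero.1 h0
    refine ⟨hI0, fun s hs x hx => ?_⟩
    obtain ⟨i, hi, hi0⟩ := Submodule.exists_mem_ne_zero_of_ne_bot hI0
    have hins : ∃ j ∈ insert i s, j ≠ 0 := ⟨i, by simp, hi0⟩
    have hle : Ideal.span ((insert i s : Finset R) : Set R) ≤ I := by
      rw [Ideal.span_le, Finset.coe_insert]
      exact Set.insert_subset hi hs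
    have : algebraMap R K x ∈ tClosure (I : FractionalIdeal R⁰ K) := by
      refine ⟨(Ideal.span ((insert i s : Finset R) : Set R) : Ideal R), ?_, ?_, ?_, ?_⟩
      · rw [FractionalIdeal.coeIdeal_ne_zero]
        intro hbot
        rw [Ideal.span_eq_bot] at hbot
        exact hi0 (hbot i (by simp))
      · exact (hfg _).2 ⟨_, rfl⟩
      · exact (FractionalIdeal.coeIdeal_le_coeIdeal K).2 hle
      · exact (algebraMap_mem_vClosure_span hins).2 (divisorialHull_mono (by simp) hx)
    rw [h] at this
    obtain ⟨y, hy, hyx⟩ := (FractionalIdeal.mem_coeIdeal _).1 this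
    rwa [← IsFractionRing.injective R K hyx]
  · rintro ⟨hI0, h⟩
    refine ⟨FractionalIdeal.coeIdeal_ne_zero.2 hI0, Set.Subset.antisymm ?_ ?_⟩
    · rintro x ⟨J, hJ0, hJfg, hJI, hx⟩
      have hJ1 : J ≤ 1 := hJI.trans FractionalIdeal.coeIdeal_le_one
      obtain ⟨x, rfl⟩ := (FractionalIdeal.mem_one_iff _).1 (vClosure_le_one hJ0 hJ1 hx)
      obtain ⟨J, rfl⟩ := FractionalIdeal.le_one_iff_exists_coeIdeal.1 hJ1
      obtain ⟨s, rfl⟩ := (hfg J).1 hJfg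
      have hs : ∃ j ∈ s, j ≠ 0 := by
        by_contra! hs
        refine hJ0 (FractionalIdeal.coeIdeal_eq_zero.2 ?_)
        exact Ideal.span_eq_bot.2 hs
      refine FractionalIdeal.mem_coeIdeal_of_mem _ (h s ?_ ?_)
      · exact Ideal.span_le.1 ((FractionalIdeal.coeIdeal_le_coeIdeal K).1 hJI)
      · exact (algebraMap_mem_vClosure_span hs).1 hx
    · intro x hx
      obtain ⟨x, hxI, rfl⟩ := (FractionalIdeal.mem_coeIdeal _).1 hx
      obtain ⟨i, hi, hi0⟩ := Submodule.exists_mem_ne_zero_of_ne_bot hI0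
      have hins : ∃ j ∈ ({i, x} : Finset R), j ≠ 0 := ⟨i, by simp, hi0⟩
      refine ⟨(Ideal.span (({i, x} : Finset R) : Set R) : Ideal R), ?_, ?_, ?_, ?_⟩
      · rw [FractionalIdeal.coeIdeal_ne_zero]
        intro hbot
        rw [Ideal.span_eq_bot] at hbot
        exact hi0 (hbot i (by simp))
      · exact (hfg _).2 ⟨_, rfl⟩
      · refine (FractionalIdeal.coeIdeal_le_coeIdeal K).2 (Ideal.span_le.2 ?_)
        intro y hy
        rcases (by simpa using hy : y = i ∨ y = x) with rfl | rfl <;> assumption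
      · exact (algebraMap_mem_vClosure_span hins).2 (subset_divisorialHull _ (by simp))

lemma mem_tMax_iff {M : Ideal R} : M ∈ tMax R K ↔ IsMaximalTIdeal M := by
  simp only [tMax, IsMaximalTIdeal, Set.mem_ofPred_eq, isTIdeal_coeIdeal_iff]

/-- For the direct implication compare all of `t-Max(R)` with `t-Max(R) \ {Q}`. Conversely a
fraction separating `Q ∈ 𝓜₁ \ 𝓜₂` from the other maximal `t`-ideals lies in the intersection over
`𝓜₂` but not in that over `𝓜₁`. -/
lemma isTSharpDomain_iff :
    IsTSharpDomain R ↔ ∀ Q : Ideal R, IsMaximalTIdeal Q → IsSharpAt Q := by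
  constructor
  · intro h Q hQ
    have hQ' : Q ∈ tMax R (FractionRing R) := mem_tMax_iff.2 hQ
    have hne := h (tMax R (FractionRing R)) (tMax R (FractionRing R) \ {Q}) subset_rfl
      Set.sdiff_subset fun heq => by
        rw [heq] at hQ'
        exact hQ'.2 rfl
    have hsub : ¬ (⋂ M ∈ tMax R (FractionRing R) \ {Q}, localizationAt (FractionRing R) M) ⊆
        ⋂ M ∈ tMax R (FractionRing R), localizationAt (FractionRing R) M := fun hsub =>
      hne (Set.Subset.antisymm (Set.biInter_subset_biInter_left Set.sdiff_subset) hsub)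
    obtain ⟨u, hu, hu'⟩ := Set.not_subset.1 hsub
    obtain ⟨a, b, hb, rfl⟩ := IsFractionRing.div_surjective (A := R) u
    have hb0 := nonZeroDivisors.ne_zero hb
    have hN : ∀ N : Ideal R, IsMaximalTIdeal N → N ≠ Q → ∃ s ∉ N, b ∣ s * a :=
      fun N hN hNQ => (div_mem_localizationAt_iff hb0).1
        (Set.mem_iInter₂.1 hu N ⟨mem_tMax_iff.2 hN, hNQ⟩)
    refine ⟨a, b, hb0, fun s hs => ?_, hN⟩
    by_contra hsQ
    refine hu' (Set.mem_iInter₂.2 fun N hNt => (div_mem_localizationAt_iff hb0).2 ?_)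
    by_cases hNQ : N = Q
    · rw [hNQ]
      exact ⟨s, hsQ, hs⟩
    · exact hN N (mem_tMax_iff.1 hNt) hNQ
  · intro h
    have key : ∀ 𝓜₁ 𝓜₂ : Set (Ideal R), 𝓜₁ ⊆ tMax R (FractionRing R) →
        𝓜₂ ⊆ tMax R (FractionRing R) →
        (⋂ M ∈ 𝓜₁, localizationAt (FractionRing R) M) =
          ⋂ M ∈ 𝓜₂, localizationAt (FractionRing R) M → 𝓜₁ ⊆ 𝓜₂ := by
      intro 𝓜₁ 𝓜₂ h₁ h₂ heq Q hQ
      by_contra hQ₂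
      obtain ⟨a, b, hb, hs, hN⟩ := h Q (mem_tMax_iff.1 (h₁ hQ))
      have hmem : algebraMap R (FractionRing R) a / algebraMap R (FractionRing R) b ∈
          ⋂ M ∈ 𝓜₂, localizationAt (FractionRing R) M :=
        Set.mem_iInter₂.2 fun N hN₂ => (div_mem_localizationAt_iff hb).2
          (hN N (mem_tMax_iff.1 (h₂ hN₂)) fun hNQ => hQ₂ (hNQ ▸ hN₂))
      rw [← heq] at hmem
      obtain ⟨s, hsQ, hsd⟩ := (div_mem_localizationAt_iff hb).1 (Set.mem_iInter₂.1 hmem Q hQ)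
      exact hsQ (hs s hsd)
    exact fun 𝓜₁ 𝓜₂ h₁ h₂ hne heq =>
      hne (Set.Subset.antisymm (key 𝓜₁ 𝓜₂ h₁ h₂ heq) (key 𝓜₂ 𝓜₁ h₂ h₁ heq.symm))

end FractionField

end TSharp

theorem theorem3p4 {R : Type*} [CommRing R] [IsDomain R] (σ : Type*)
    (hR : TSharp.IsTSharpDomain R) : TSharp.IsTSharpDomain (MvPolynomial σ R) := by
  rw [TSharp.isTSharpDomain_iff] at hR ⊢
  intro Q hQ
  by_cases h : ∀ d : R, MvPolynomial.C d ∈ Q → d = 0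
  · exact hQ.isSharpAt_of_forall_C_notMem h
  · push Not at h
    obtain ⟨d, hdQ, hd⟩ := h
    exact hQ.isSharpAt_of_C_mem hR hd hdQ
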